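/- Let $N$ be a finite set with $|N|\ge 2$. A DAG over $N$ is an acyclic directed graph with node set $N$; write $\mathrm{pa}_G(a)=\{b\in N: b\to a \text{ in } G\}$. Two DAGs $G,H$ over $N$ are Markov equivalent, $G\sim H$, if they have the same adjacencies and the same immoralities (an immorality is an induced subgraph $a\to c\leftarrow b$ with $a\neq b$ and $a,b$ not adjacent). A DAG is full if any two distinct nodes are adjacent; the full graphs form one Markov equivalence class. Let $\Gamma=\{(a,B): a\in N,\ \emptyset\ne B\subseteq N\setminus\{a\}\}$. The code of a DAG $G$ is the vector $\eta_G\in\mathbb{R}^{\Gamma}$ with $\eta_G(a,B)=1$ if $B=\mathrm{pa}_G(a)$ and $\eta_G(a,B)=0$ otherwise, and the family-variable polytope $P$ is the convex hull of the codes of all DAGs over $N$. A face of $P$ is a set of the form $F=\{v\in P:\langle o,v\rangle=u\}$, where $o\in\mathbb{R}^{\Gamma}$, $u\in\mathbb{R}$ and $\langle o,v\rangle\le u$ for all $v\in P$; we say that $(o,u)$ defines $F$. A facet of $P$ is a face whose affine hull has dimension $\dim P-1$ (with $\dim\emptyset=-1$). A set $\mathcal{S}$ of DAGs over $N$ is called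 a facet of $P$ if $F_{\mathcal S}:=\mathrm{conv}\{\eta_G: G\in\mathcal{S}\}$ is a facet of $P$. **Theorem.** Let the set $\mathcal{S}$ of DAGs over $N$ be a facet of the family-variable polytope $P$. Then the following conditions are equivalent: (a) $\mathcal{S}$ is closed under Markov equivalence: if $G\in\mathcal{S}$ and $G\sim H$, then $H\in\mathcal{S}$; (b) $\mathcal{S}$ contains the whole Markov equivalence class of full graphs, that is, every full graph over $N$; (c) $\mathcal{S}$ is score equivalent: $F_{\mathcal S}$ is defined by some pair $(o,u)$ with $u\in\mathbb{R}$ and $o\in\mathbb{R}^{\Gamma}$ satisfying $\langle o,\eta_G\rangle=\langle o,\eta_H\rangle$ for all DAGs $G\sim H$ over $N$. -/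

import Mathlib

/-! Acyclic directed graphs -/

/-- An acyclic directed graph with node set `N`: no node can be reached from itself along a
non-empty directed path (in particular there are no loops and no 2-cycles).
`G.Adj a b` means that `a → b` is an arrow of `G`. -/
structure DAG (N : Type*) extends Digraph N where
  acyclic : ∀ a : N, ¬ Relation.TransGen Adj a a

namespace DAG

variable {N : Type*}

/-- Two nodes are adjacent if there is an arrow between them, in either direction. -/
def Adjacent (G : DAG N) (a b : N) : Prop := G.Adj a b ∨ G.Adj b a

/-- A full graph: any two distinct nodes are adjacent. -/
def IsFull (G : DAG N) : Prop := ∀ a b : N, a ≠ b → G.Adjacent a b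

/-- `a → c ← b` is an immorality of `G`: an induced subgraph with `a ≠ b` not adjacent. -/
def IsImmorality (G : DAG N) (a c b : N) : Prop :=
  a ≠ b ∧ G.Adj a c ∧ G.Adj b c ∧ ¬ G.Adjacent a b

/-- Markov equivalence: the same adjacencies and the same immoralities. -/
def MarkovEquiv (G H : DAG N) : Prop :=
  (∀ a b : N, G.Adjacent a b ↔ H.Adjacent a b) ∧
    ∀ a c b : N, G.IsImmorality a c b ↔ H.IsImmorality a c b

open Classical in
/-- The parent set of the node `a`. -/
noncomputable def parents [Fintype N] (G : DAG N) (a : N) : Finset N :=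
  Finset.univ.filter fun b => G.Adj b a

end DAG

/-- A set of acyclic directed graphs is closed under Markov equivalence. -/
def ClosedUnderMarkovEquiv {N : Type*} (S : Set (DAG N)) : Prop :=
  ∀ G H : DAG N, G.MarkovEquiv H → G ∈ S → H ∈ S

/-! Faces and facets of a convex set in a finite coordinate space -/

/-- The inequality `⟨o, v⟩ ≤ u` is valid on `P` and defines the subset `F` of `P`. -/
def DefinesFace {ι : Type*} [Fintype ι] (P F : Set (ι → ℝ)) (o : ι → ℝ) (u : ℝ) : Prop :=
  (∀ v ∈ P, o ⬝ᵥ v ≤ u) ∧ F = {v | v ∈ P ∧ o ⬝ᵥ v = u}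

/-- `F` is a (possibly empty or improper) face of `P`. -/
def IsFaceOf {ι : Type*} [Fintype ι] (P F : Set (ι → ℝ)) : Prop :=
  ∃ (o : ι → ℝ) (u : ℝ), DefinesFace P F o u

open Classical in
/-- The dimension of the affine hull of `s`, with the empty set having dimension `-1`. -/
noncomputable def affineDim {ι : Type*} (s : Set (ι → ℝ)) : ℤ :=
  if s = ∅ then -1 else (Module.finrank ℝ (vectorSpan ℝ s) : ℤ)

/-- `F` is a facet of `P`: a face of dimension `dim P - 1`. -/
def IsFacetOf {ι : Type*} [Fintype ι] (P F : Set (ι → ℝ)) : Prop :=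
  IsFaceOf P F ∧ affineDim F = affineDim P - 1

/-! The family-variable polytope -/

section FamilyVariable

variable {N : Type*} [Fintype N] [DecidableEq N]

/-- The index set of family-variable vectors: pairs `(a, B)` with `∅ ≠ B ⊆ N \ {a}`. -/
abbrev FamilyIndex (N : Type*) : Type _ := {p : N × Finset N // p.2.Nonempty ∧ p.1 ∉ p.2}

/-- The family-variable vector (DAG-code) of `G`. -/
noncomputable def famVec (G : DAG N) : FamilyIndex N → ℝ :=
  fun p => if p.1.2 = G.parents p.1.1 then 1 else 0

/-- The convex hull of the codes of the graphs in `S`. -/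
noncomputable def codeHull (S : Set (DAG N)) : Set (FamilyIndex N → ℝ) :=
  convexHull ℝ (famVec '' S)

/-- The family-variable polytope: the convex hull of all DAG-codes over `N`. -/
noncomputable def familyVariablePolytope (N : Type*) [Fintype N] [DecidableEq N] :
    Set (FamilyIndex N → ℝ) :=
  convexHull ℝ (Set.range (famVec : DAG N → FamilyIndex N → ℝ))

/-- A score equivalent objective: it takes the same value on Markov equivalent graphs. -/
def IsSEObjective (o : FamilyIndex N → ℝ) : Prop :=
  ∀ G H : DAG N, G.MarkovEquiv H → o ⬝ᵥ famVec G = o ⬝ᵥ famVec H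

/-- A set of graphs is a facet of the family-variable polytope if the hull of their codes is. -/
def IsFacetSet (S : Set (DAG N)) : Prop :=
  IsFacetOf (familyVariablePolytope N) (codeHull S)

/-- A subset `F` of the family-variable polytope is a score equivalent face: some score equivalent
objective defines it. -/
def IsSEFace (F : Set (FamilyIndex N → ℝ)) : Prop :=
  ∃ (o : FamilyIndex N → ℝ) (u : ℝ),
    IsSEObjective o ∧ DefinesFace (familyVariablePolytope N) F o u

end FamilyVariable

open Finset

/-! ### Acyclic graphs, full graphs and Markov equivalence -/

namespace DAG

variable {N : Type*}

/-! Let `(o, u)` define the facet; a graph is in `S` iff its score is `u`, so (c) gives (a).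

For (b) ⇒ (c), full graphs differing by a swap of consecutive nodes have equal scores, which is an
exchange identity for local scores. They are then increments of a set function, and Möbius inversion
makes the score a sum over the sets `T` with `HasCollector`, a Markov invariant
(`isSEObjective_of_isFull`).

For (a) ⇒ (b), one full graph in `S` suffices (`IsFacetSet.exists_isFull`). If local scores are
monotone in the parent set, completing a member of `S` keeps it optimal. Otherwise some family
occurs in no member of `S`; the facet then lies in a coordinate hyperplane and contains every code
there, among them that of a full graph. -/

theorem ext_adj {G H : DAG N} (h : ∀ a b, G.Adj a b ↔ H.Adj a b) : G = H := by
  have : G.Adj = H.Adj := by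
    funext a b
    exact propext (h a b)
  rcases G with ⟨⟨⟩, _⟩
  rcases H with ⟨⟨⟩, _⟩
  simp_all

theorem not_adj_self (G : DAG N) (a : N) : ¬ G.Adj a a := fun h => G.acyclic a (.single h)

theorem Adj.asymm {G : DAG N} {a b : N} (h : G.Adj a b) : ¬ G.Adj b a :=
  fun h' => G.acyclic a ((Relation.TransGen.single h).tail h')

theorem not_triangle {G : DAG N} {a b c : N} (h : G.Adj a b) (h' : G.Adj b c) : ¬ G.Adj c a :=
  fun h'' => G.acyclic a (((Relation.TransGen.single h).tail h').tail h'')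

theorem MarkovEquiv.symm {G H : DAG N} (h : G.MarkovEquiv H) : H.MarkovEquiv G :=
  ⟨fun a b => (h.1 a b).symm, fun a c b => (h.2 a c b).symm⟩

theorem IsFull.markovEquiv {G H : DAG N} (hG : G.IsFull) (hH : H.IsFull) : G.MarkovEquiv H := by
  refine ⟨fun a b => ?_, fun a c b => ?_⟩
  · by_cases hab : a = b
    · subst hab
      simp [Adjacent, not_adj_self]
    · exact ⟨fun _ => hH a b hab, fun _ => hG a b hab⟩
  · exact ⟨fun h => absurd (hG a b h.1) h.2.2.2, fun h => absurd (hH a b h.1) h.2.2.2⟩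

/-- The graph obtained from a transitive irreflexive relation. -/
def ofStrictOrder (r : N → N → Prop) (htrans : ∀ a b c, r a b → r b c → r a c)
    (hirrefl : ∀ a, ¬ r a a) : DAG N where
  Adj := r
  acyclic a h := by
    have : ∀ b, Relation.TransGen r a b → r a b := by
      intro b hb
      induction hb with
      | single h => exact h
      | tail _ h ih => exact htrans _ _ _ ih h
    exact hirrefl a (this a h)

/-- The full graph in which arrows go from smaller to larger values of an injective ranking. -/
def ofRank (r : N → ℕ) : DAG N :=
  ofStrictOrder (fun a b => r a < r b) (fun _ _ _ => lt_trans) (fun _ => lt_irrefl _)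

theorem ofRank_isFull {r : N → ℕ} (hr : Function.Injective r) : (ofRank r).IsFull :=
  fun _ _ hab => lt_or_gt_of_ne (hr.ne hab)

/-- Every graph is a subgraph of a full graph. -/
theorem exists_isFull_ge (G : DAG N) : ∃ H : DAG N, H.IsFull ∧ ∀ a b, G.Adj a b → H.Adj a b := by
  have : IsPartialOrder N (Relation.ReflTransGen G.Adj) :=
    { refl := fun _ => .refl
      trans := fun _ _ _ => .trans
      antisymm := fun a b hab hba => by
        by_contra hne
        rcases Relation.reflTransGen_iff_eq_or_transGen.1 hab with h | h
        · exact hne h.symm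
        · exact G.acyclic a (h.trans_left hba) }
  obtain ⟨s, hs, hle⟩ := extend_partialOrder (Relation.ReflTransGen G.Adj)
  refine ⟨ofStrictOrder (fun a b => s a b ∧ a ≠ b) ?_ ?_, ?_, ?_⟩
  · rintro a b c ⟨h, hne⟩ ⟨h', _⟩
    refine ⟨_root_.trans h h', ?_⟩
    rintro rfl
    exact hne (antisymm h h')
  · simp
  · intro a b hab
    rcases total_of s a b with h | h
    · exact .inl ⟨h, hab⟩
    · exact .inr ⟨h, hab.symm⟩
  · intro a b h
    refine ⟨hle _ _ (.single h), ?_⟩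
    rintro rfl
    exact G.not_adj_self _ h

/-- A subgraph of an acyclic graph. -/
def ofLE (G : DAG N) (r : N → N → Prop) (h : ∀ a b, r a b → G.Adj a b) : DAG N where
  Adj := r
  acyclic a ha := G.acyclic a (Relation.TransGen.mono h _ _ ha)

/-- The graph whose only arrows are those from the members of `C` to `b`. -/
def star (b : N) (C : Set N) (hb : b ∉ C) : DAG N :=
  ofStrictOrder (fun x y => y = b ∧ x ∈ C) (by rintro x y z ⟨rfl, _⟩ ⟨_, h⟩; exact absurd h hb)
    (by rintro x ⟨rfl, h⟩; exact hb h)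

variable [Fintype N]

@[simp] theorem mem_parents {G : DAG N} {a b : N} : b ∈ G.parents a ↔ G.Adj b a := by
  simp [parents]

theorem self_notMem_parents (G : DAG N) (a : N) : a ∉ G.parents a := by
  simp [not_adj_self]

@[simp] theorem parents_star (b : N) (C : Finset N) (hb : b ∉ C) :
    (star b (C : Set N) hb).parents b = C := by
  ext x
  rw [mem_parents]
  simp [star, ofStrictOrder]

/-- `T` is contained in a family of `G` with the child in `T`; the sets with this property are
the ones at which the characteristic imset of `G` takes the value one. -/
def HasCollector (G : DAG N) (T : Finset N) : Prop :=
  ∃ a ∈ T, ∀ x ∈ T, x ≠ a → G.Adj x a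

theorem exists_sink (G : DAG N) {E : Finset N} (hE : E.Nonempty) :
    ∃ b ∈ E, ∀ x ∈ E, ¬ G.Adj b x := by
  have htr : IsTrans N (Relation.TransGen (flip G.Adj)) := ⟨fun _ _ _ => .trans⟩
  have hirr : Std.Irrefl (Relation.TransGen (flip G.Adj)) :=
    ⟨fun a h => G.acyclic a (Relation.transGen_swap.1 h)⟩
  have wf : WellFounded (Relation.TransGen (flip G.Adj)) :=
    Finite.wellFounded_of_trans_of_irrefl _
  obtain ⟨b, hb, hmin⟩ := wf.has_min (E : Set N) hE
  exact ⟨b, hb, fun x hx h => hmin x hx (.single h)⟩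

/-- If the collector `a` has children within `T` in `H`, a sink `b` among them takes over: a node of
`T` not adjacent to `b` would form an immorality at `a`, contradicting `a → b` in `H`. -/
theorem HasCollector.of_markovEquiv {G H : DAG N} (h : G.MarkovEquiv H) {T : Finset N}
    (hT : G.HasCollector T) : H.HasCollector T := by
  classical
  obtain ⟨a, haT, ha⟩ := hT
  by_cases hE : (T.filter fun x => H.Adj a x).Nonempty
  · obtain ⟨b, hb, hsink⟩ := H.exists_sink hE
    obtain ⟨hbT, hab⟩ := mem_filter.1 hb
    have hba : b ≠ a := by
      rintro rfl
      exact H.not_adj_self _ hab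
    refine ⟨b, hbT, fun x hx hxb => ?_⟩
    by_cases hxa : x = a
    · exact hxa ▸ hab
    have hadj : H.Adjacent x b := by
      by_contra hn
      have himm : G.IsImmorality x a b :=
        ⟨hxb, ha x hx hxa, ha b hbT hba, fun h' => hn ((h.1 _ _).1 h')⟩
      exact Adj.asymm hab ((h.2 _ _ _).1 himm).2.2.1
    refine hadj.resolve_right fun hbx => ?_
    rcases (h.1 x a).1 (.inl (ha x hx hxa)) with hx' | hx'
    · exact not_triangle hab hbx hx'
    · exact hsink x (mem_filter.2 ⟨hx, hx'⟩) hbx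
  · refine ⟨a, haT, fun x hx hxa => ?_⟩
    exact ((h.1 x a).1 (.inl (ha x hx hxa))).resolve_right
      fun hx' => hE ⟨x, mem_filter.2 ⟨hx, hx'⟩⟩

theorem MarkovEquiv.hasCollector_iff {G H : DAG N} (h : G.MarkovEquiv H) (T : Finset N) :
    G.HasCollector T ↔ H.HasCollector T :=
  ⟨.of_markovEquiv h, .of_markovEquiv h.symm⟩

end DAG

/-! ### Potentials and Möbius inversion -/

section Potential

variable {N : Type*} [DecidableEq N]

/-- A local score whose increments are independent of the order is a difference of a set
function. -/
theorem exists_potential (w : N → Finset N → ℝ)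
    (hw : ∀ a b B, a ≠ b → a ∉ B → b ∉ B →
      w a B + w b (insert a B) = w b B + w a (insert b B)) :
    ∃ m : Finset N → ℝ, ∀ a B, a ∉ B → w a B = m (insert a B) - m B := by
  classical
  let m : Finset N → ℝ := Finset.strongInduction fun A ih =>
    if h : A.Nonempty then ih (A.erase h.choose) (erase_ssubset h.choose_spec) +
      w h.choose (A.erase h.choose) else 0
  have hm : ∀ A (h : A.Nonempty), m A = m (A.erase h.choose) + w h.choose (A.erase h.choose) := by
    intro A h
    simp only [m]
    rw [Finset.strongInduction_eq, dif_pos h]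
  -- The choice made in defining `m` is irrelevant: two elements may be removed in either order.
  have key : ∀ A : Finset N, ∀ a ∈ A, m A = m (A.erase a) + w a (A.erase a) := by
    intro A
    induction A using Finset.strongInduction with
    | H A ih =>
      intro a ha
      have hne : A.Nonempty := ⟨a, ha⟩
      have h0 := hm A hne
      have hx := hne.choose_spec
      generalize hne.choose = x at h0 hx
      by_cases hax : a = x
      · rw [hax, h0]
      have h1 := ih _ (erase_ssubset hx) a (mem_erase.2 ⟨hax, ha⟩)
      have h2 := ih _ (erase_ssubset ha) x (mem_erase.2 ⟨Ne.symm hax, hx⟩)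
      have h3 := hw a x ((A.erase a).erase x) hax (by simp) (by simp)
      rw [insert_erase (mem_erase.2 ⟨Ne.symm hax, hx⟩)] at h3
      rw [erase_right_comm] at h3
      rw [insert_erase (mem_erase.2 ⟨hax, ha⟩)] at h3
      rw [erase_right_comm (a := a)] at h2
      linarith
  refine ⟨m, fun a B ha => ?_⟩
  have := key (insert a B) a (mem_insert_self _ _)
  rw [erase_insert ha] at this
  linarith

theorem exists_moebius (m : Finset N → ℝ) :
    ∃ l : Finset N → ℝ, ∀ A, m A = ∑ T ∈ A.powerset, l T := by
  let l : Finset N → ℝ := Finset.strongInduction fun A ih =>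
    m A - ∑ T ∈ A.ssubsets.attach, ih T.1 (mem_ssubsets.1 T.2)
  have hl : ∀ A, l A = m A - ∑ T ∈ A.ssubsets, l T := by
    intro A
    rw [← sum_attach A.ssubsets]
    simp only [l]
    rw [Finset.strongInduction_eq]
  refine ⟨l, fun A => ?_⟩
  rw [← insert_erase (mem_powerset_self A), sum_insert (notMem_erase _ _), hl A]
  simp [Finset.ssubsets]

variable [Fintype N]

open Classical in
/-- The sum of the increments of a set function over the families of a graph depends on the
characteristic imset only. -/
theorem sum_increments_eq (G : DAG N) (m l : Finset N → ℝ)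
    (hl : ∀ A, m A = ∑ T ∈ A.powerset, l T) :
    ∑ a, (m (insert a (G.parents a)) - m (G.parents a)) =
      ∑ T, if G.HasCollector T then l T else 0 := by
  have h1 : ∀ a, m (insert a (G.parents a)) - m (G.parents a) =
      ∑ T, if a ∈ T ∧ ∀ x ∈ T, x ≠ a → G.Adj x a then l T else 0 := by
    intro a
    have e : ∀ A : Finset N, m A = ∑ T, if T ⊆ A then l T else 0 := by
      intro A
      rw [hl, ← sum_filter]
      congr 1
      ext
      simp
    rw [e, e, ← sum_sub_distrib]
    refine sum_congr rfl fun T _ => ?_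
    have hsub : T ⊆ insert a (G.parents a) ↔ ∀ x ∈ T, x ≠ a → G.Adj x a := by
      simp only [subset_iff, mem_insert, DAG.mem_parents, or_iff_not_imp_left, ne_eq]
    by_cases haT : a ∈ T
    · have hn : ¬ T ⊆ G.parents a := fun h => G.self_notMem_parents a (h haT)
      simp [hsub, hn, haT]
    · have : T ⊆ insert a (G.parents a) ↔ T ⊆ G.parents a := subset_insert_iff_of_notMem haT
      simp [this, haT]
  simp_rw [h1]
  rw [sum_comm]
  refine sum_congr rfl fun T _ => ?_
  split_ifs with hT
  · obtain ⟨a, haT, ha⟩ := hT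
    -- By asymmetry of arrows a set has at most one collector, so `l T` is counted once.
    rw [sum_eq_single a]
    · rw [if_pos ⟨haT, ha⟩]
    · rintro b - hba
      rw [if_neg]
      rintro ⟨hbT, hb⟩
      exact DAG.Adj.asymm (ha b hbT hba) (hb a haT hba.symm)
    · simp
  · refine sum_eq_zero fun a _ => if_neg fun h => hT ⟨a, h⟩

end Potential

/-! ### Codes as vertices -/

section FamilyVariable

variable {N : Type*} [Fintype N] [DecidableEq N]

/-- The extension of an objective to all pairs `(a, B)`, with value zero outside the index set. -/
noncomputable def localScore (o : FamilyIndex N → ℝ) (a : N) (B : Finset N) : ℝ :=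
  if h : B.Nonempty ∧ a ∉ B then o ⟨(a, B), h⟩ else 0

/-- The default value zero in `localScore` accounts for nodes without parents, which have no
coordinate. -/
theorem dotProduct_famVec (o : FamilyIndex N → ℝ) (G : DAG N) :
    o ⬝ᵥ famVec G = ∑ a, localScore o a (G.parents a) := by
  classical
  have h1 : o ⬝ᵥ famVec G = ∑ p : N × Finset N,
      if p.2 = G.parents p.1 then localScore o p.1 p.2 else 0 := by
    rw [← sum_subset (subset_univ (univ.filter fun p : N × Finset N => p.2.Nonempty ∧ p.1 ∉ p.2))]
    · rw [sum_subtype (p := fun p : N × Finset N => p.2.Nonempty ∧ p.1 ∉ p.2) _ (by simp)]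
      refine sum_congr rfl fun p _ => ?_
      simp only [famVec, localScore, dif_pos p.2, mul_ite, mul_one, mul_zero]
    · intro p _ hp
      have : ¬ (p.2.Nonempty ∧ p.1 ∉ p.2) := by simpa using hp
      simp [localScore, this]
  rw [h1, Fintype.sum_prod_type]
  simp

theorem famVec_injective : Function.Injective (famVec : DAG N → FamilyIndex N → ℝ) := by
  have key : ∀ {G H : DAG N}, famVec G = famVec H → ∀ a b, G.Adj a b → H.Adj a b := by
    intro G H h a b hab
    have := congrFun h ⟨(b, G.parents b), ⟨a, DAG.mem_parents.2 hab⟩, G.self_notMem_parents b⟩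
    simp only [famVec, if_true] at this
    have hp : G.parents b = H.parents b := by
      by_contra hn
      simp [hn] at this
    rw [← DAG.mem_parents, ← hp]
    simpa using hab
  exact fun G H h => DAG.ext_adj fun a b => ⟨key h a b, key h.symm a b⟩

/-- Codes are 0/1 vectors, and `2 * famVec G - 1` is maximised over such vectors only at `famVec G`.
-/
theorem famVec_mem_codeHull {S : Set (DAG N)} {G : DAG N} :
    famVec G ∈ codeHull S ↔ G ∈ S := by
  refine ⟨fun hG => ?_, fun hG => subset_convexHull ℝ _ ⟨G, hG, rfl⟩⟩
  let c : FamilyIndex N → ℝ := fun p => 2 * famVec G p - 1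
  obtain ⟨H, hH, hle⟩ : ∃ H ∈ S, c ⬝ᵥ famVec G ≤ c ⬝ᵥ famVec H := by
    by_contra! hn
    have hconv : Convex ℝ {v | c ⬝ᵥ v < c ⬝ᵥ famVec G} :=
      convex_halfSpace_lt ⟨dotProduct_add c, fun r v => dotProduct_smul r c v⟩ _
    have := convexHull_min (by rintro _ ⟨H, hH, rfl⟩; exact hn H hH) hconv hG
    exact lt_irrefl (c ⬝ᵥ famVec G) this
  have hterm : ∀ p ∈ univ, 0 ≤ c p * (famVec G p - famVec H p) := by
    intro p _
    simp only [c, famVec]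
    split_ifs <;> norm_num
  have hsum : ∑ p, c p * (famVec G p - famVec H p) = 0 := by
    refine le_antisymm ?_ (sum_nonneg hterm)
    simp only [mul_sub, sum_sub_distrib]
    exact sub_nonpos.2 hle
  have heq := (sum_eq_zero_iff_of_nonneg hterm).1 hsum
  have : famVec G = famVec H := by
    funext p
    have := heq p (mem_univ p)
    simp only [c, famVec] at this ⊢
    split_ifs at this ⊢ <;> first | rfl | norm_num at this
  exact famVec_injective this ▸ hH

theorem famVec_mem_familyVariablePolytope (G : DAG N) : famVec G ∈ familyVariablePolytope N :=
  subset_convexHull ℝ _ ⟨G, rfl⟩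

theorem DefinesFace.mem_iff {S : Set (DAG N)} {o : FamilyIndex N → ℝ} {u : ℝ}
    (h : DefinesFace (familyVariablePolytope N) (codeHull S) o u) (G : DAG N) :
    G ∈ S ↔ o ⬝ᵥ famVec G = u := by
  rw [← famVec_mem_codeHull, h.2]
  exact ⟨fun h => h.2, fun h' => ⟨famVec_mem_familyVariablePolytope G, h'⟩⟩

/-! ### Score equivalent objectives -/

/-- An objective whose local scores satisfy the exchange condition is score equivalent. -/
theorem isSEObjective_of_exchange (o : FamilyIndex N → ℝ)
    (hw : ∀ a b B, a ≠ b → a ∉ B → b ∉ B →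
      localScore o a B + localScore o b (insert a B) =
        localScore o b B + localScore o a (insert b B)) :
    IsSEObjective o := by
  classical
  obtain ⟨m, hm⟩ := exists_potential _ hw
  obtain ⟨l, hl⟩ := exists_moebius m
  intro G H hGH
  have key : ∀ G : DAG N, o ⬝ᵥ famVec G = ∑ T, if G.HasCollector T then l T else 0 := by
    intro G
    rw [dotProduct_famVec, ← sum_increments_eq G m l hl]
    exact sum_congr rfl fun a _ => hm _ _ (G.self_notMem_parents a)
  rw [key, key]
  simp only [hGH.hasCollector_iff]

/-- A ranking in which the members of `B` come first, then `a`, then `b`. -/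
theorem exists_rank (B : Finset N) {a b : N} (hab : a ≠ b) (ha : a ∉ B) (hb : b ∉ B) :
    ∃ r : N → ℕ, Function.Injective r ∧ (∀ x, r x < r a ↔ x ∈ B) ∧ r b = r a + 1 := by
  classical
  let e := Fintype.equivFin N
  set n := Fintype.card N
  let r : N → ℕ := fun x => if x ∈ B then e x else if x = a then n else if x = b then n + 1
    else n + 2 + e x
  have hra : r a = n := by simp [r, ha]
  have hrb : r b = n + 1 := by simp [r, hb, hab.symm]
  refine ⟨r, fun x y hxy => ?_, fun x => ?_, by rw [hra, hrb]⟩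
  · have hx := (e x).2
    have hy := (e y).2
    have hinj : (e x : ℕ) = e y → x = y := fun h => e.injective (Fin.ext h)
    simp only [r] at hxy
    split_ifs at hxy <;> first | (subst_vars; rfl) | (exact hinj (by omega))
  · have hx := (e x).2
    rw [hra]
    simp only [r]
    split_ifs <;> simp_all
    omega

/-- If an objective is constant on full graphs, then it is score equivalent. -/
theorem isSEObjective_of_isFull (o : FamilyIndex N → ℝ) (u : ℝ)
    (h : ∀ G : DAG N, G.IsFull → o ⬝ᵥ famVec G = u) : IsSEObjective o := by
  refine isSEObjective_of_exchange o fun a b B hab ha hb => ?_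
  obtain ⟨r, hr, hrB, hrb⟩ := exists_rank B hab ha hb
  -- Since `a` and `b` have consecutive ranks, the swap changes only their own parent sets.
  let s : N → ℕ := r ∘ Equiv.swap a b
  have hs : Function.Injective s := hr.comp (Equiv.injective _)
  have hsa : s a = r b := by simp [s]
  have hsb : s b = r a := by simp [s]
  have hso : ∀ x, x ≠ a → x ≠ b → s x = r x := fun x h1 h2 => by
    simp [s, Equiv.swap_apply_of_ne_of_ne h1 h2]
  have hnea : ∀ x, x ≠ a → r x ≠ r a := fun x hx => hr.ne hx
  have hneb : ∀ x, x ≠ b → r x ≠ r b := fun x hx => hr.ne hx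
  have hpar : ∀ (r : N → ℕ) x y, x ∈ (DAG.ofRank r).parents y ↔ r x < r y := fun r x y =>
    DAG.mem_parents
  have h1 := h _ (DAG.ofRank_isFull hr)
  have h2 := h _ (DAG.ofRank_isFull hs)
  rw [dotProduct_famVec] at h1 h2
  have hb' : b ∈ univ.erase a := mem_erase.2 ⟨hab.symm, mem_univ b⟩
  rw [← add_sum_erase _ _ (mem_univ a), ← add_sum_erase _ _ hb'] at h1 h2
  have hrest : ∀ x ∈ (univ.erase a).erase b,
      localScore o x ((DAG.ofRank s).parents x) = localScore o x ((DAG.ofRank r).parents x) := by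
    intro x hx
    obtain ⟨hxb, hxa, -⟩ : x ≠ b ∧ x ≠ a ∧ True := by simpa using hx
    congr 1
    ext y
    rw [hpar, hpar, hso x hxa hxb]
    have := hnea x hxa
    have := hneb x hxb
    by_cases hya : y = a
    · rw [hya, hsa]
      omega
    by_cases hyb : y = b
    · rw [hyb, hsb]
      omega
    rw [hso y hya hyb]
  rw [sum_congr rfl hrest] at h2
  have e1 : (DAG.ofRank r).parents a = B := by
    ext y
    rw [hpar, hrB]
  have e2 : (DAG.ofRank r).parents b = insert a B := by
    ext y
    rw [hpar, mem_insert, ← hrB, hrb, Nat.lt_succ_iff, le_iff_lt_or_eq, hr.eq_iff, or_comm]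
  have e3 : (DAG.ofRank s).parents b = B := by
    ext y
    rw [hpar, hsb]
    by_cases hya : y = a
    · rw [hya, hsa]
      simp [ha, hrb]
    by_cases hyb : y = b
    · rw [hyb, hsb]
      simp [hb]
    rw [hso y hya hyb, hrB]
  have e4 : (DAG.ofRank s).parents a = insert b B := by
    ext y
    rw [hpar, hsa, mem_insert]
    by_cases hya : y = a
    · rw [hya, hsa]
      simp [ha, hab]
    by_cases hyb : y = b
    · rw [hyb, hsb]
      simp [hrb]
    have := hnea y hya
    rw [hso y hya hyb, hrb, ← hrB]
    simp only [hyb, false_or]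
    omega
  rw [e1, e2] at h1
  rw [e3, e4] at h2
  linarith

/-! ### Facets and full graphs -/

/-- A facet is nonempty. -/
theorem IsFacetSet.nonempty (hN : 2 ≤ Fintype.card N) {S : Set (DAG N)} (hS : IsFacetSet S) :
    S.Nonempty := by
  by_contra hne
  obtain rfl := Set.not_nonempty_iff_eq_empty.1 hne
  obtain ⟨a, b, hab⟩ := Fintype.exists_pair_of_one_lt_card (show 1 < Fintype.card N by omega)
  have hd := hS.2
  have hP : familyVariablePolytope N ≠ ∅ := Set.Nonempty.ne_empty
    ⟨_, famVec_mem_familyVariablePolytope (DAG.star a (∅ : Set N) (by simp))⟩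
  simp only [affineDim, codeHull, Set.image_empty, convexHull_empty, if_true, if_neg hP] at hd
  -- An empty facet would force `dim P = 0`, yet two star graphs have distinct codes.
  have h0 : vectorSpan ℝ (familyVariablePolytope N) = ⊥ := Submodule.finrank_eq_zero.1 (by omega)
  have hsub := (vectorSpan_eq_bot_iff_subsingleton ℝ).1 h0
  have heq := famVec_injective (hsub
    (famVec_mem_familyVariablePolytope (DAG.star a ((∅ : Finset N) : Set N) (by simp)))
    (famVec_mem_familyVariablePolytope (DAG.star a (({b} : Finset N) : Set N) (by simpa using hab))))
  have := congrArg (fun G : DAG N => G.parents a) heq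
  simp only [DAG.parents_star] at this
  exact (singleton_ne_empty b) this.symm

/-- A facet contained in a coordinate hyperplane contains all codes in that hyperplane. -/
theorem IsFacetSet.mem_of_parents_ne (hN : 2 ≤ Fintype.card N) {S : Set (DAG N)}
    (hS : IsFacetSet S) {b : N} {C : Finset N} (hC : C.Nonempty) (hb : b ∉ C)
    (hSC : ∀ G ∈ S, G.parents b ≠ C) {H : DAG N} (hH : H.parents b ≠ C) : H ∈ S := by
  obtain ⟨K, hK⟩ := hS.nonempty hN
  obtain ⟨⟨o, u, hou⟩, hd⟩ := hS
  set P := familyVariablePolytope N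
  have hF : codeHull S ≠ ∅ := Set.Nonempty.ne_empty ⟨_, famVec_mem_codeHull.2 hK⟩
  have hP : P ≠ ∅ := Set.Nonempty.ne_empty ⟨_, famVec_mem_familyVariablePolytope K⟩
  simp only [affineDim, if_neg hF, if_neg hP] at hd
  let g : FamilyIndex N := ⟨(b, C), hC, hb⟩
  have hval : ∀ G : DAG N, G.parents b ≠ C → famVec G g = 0 := fun G hG => if_neg hG.symm
  have hFg : ∀ v ∈ codeHull S, v g = 0 := by
    refine convexHull_min (t := {v : FamilyIndex N → ℝ | v g = 0}) ?_ ?_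
    · rintro _ ⟨G, hG, rfl⟩
      exact hval G (hSC G hG)
    · exact (LinearMap.ker (LinearMap.proj (R := ℝ) (φ := fun _ => ℝ) g)).convex
  -- `W` lies properly below the direction of `P`, as a star has coordinate one at `g`. It contains
  -- the direction of the facet, of codimension one, so the two agree.
  let W : Submodule ℝ (FamilyIndex N → ℝ) :=
    vectorSpan ℝ P ⊓ LinearMap.ker (LinearMap.proj (R := ℝ) (φ := fun _ => ℝ) g)
  have hsub : codeHull S ⊆ P := fun v hv => by
    rw [hou.2] at hv
    exact hv.1
  have hFW : vectorSpan ℝ (codeHull S) ≤ W := by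
    refine le_inf (vectorSpan_mono ℝ hsub) ?_
    rw [vectorSpan_def, Submodule.span_le]
    rintro _ ⟨x, hx, y, hy, rfl⟩
    simp [hFg x hx, hFg y hy]
  have hWP : W < vectorSpan ℝ P := by
    refine lt_of_le_of_ne inf_le_left fun heq => ?_
    have hmem : famVec (DAG.star b (C : Set N) hb) -ᵥ famVec K ∈ vectorSpan ℝ P :=
      vsub_mem_vectorSpan ℝ (famVec_mem_familyVariablePolytope _)
        (famVec_mem_familyVariablePolytope _)
    rw [← heq] at hmem
    have h0 : famVec (DAG.star b (C : Set N) hb) g - famVec K g = 0 := hmem.2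
    rw [hval K (hSC K hK)] at h0
    simp [famVec, g, DAG.parents_star] at h0
  have hlt := Submodule.finrank_lt_finrank_of_lt hWP
  have hle := Submodule.finrank_mono hFW
  have hFW' : vectorSpan ℝ (codeHull S) = W :=
    Submodule.eq_of_le_of_finrank_eq hFW (by omega)
  have hHK : famVec H -ᵥ famVec K ∈ vectorSpan ℝ (codeHull S) := by
    rw [hFW']
    refine ⟨vsub_mem_vectorSpan ℝ (famVec_mem_familyVariablePolytope _)
        (famVec_mem_familyVariablePolytope _), ?_⟩
    simp [hval H hH, hval K (hSC K hK)]
  have hker : ∀ v ∈ vectorSpan ℝ (codeHull S), o ⬝ᵥ v = 0 := by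
    intro v hv
    rw [vectorSpan_def] at hv
    induction hv using Submodule.span_induction with
    | mem v hv =>
      obtain ⟨x, hx, y, hy, rfl⟩ := hv
      rw [hou.2] at hx hy
      simp [dotProduct_sub, hx.2, hy.2]
    | zero => simp
    | add x y _ _ hx hy => simp [dotProduct_add, hx, hy]
    | smul r x _ hx => simp [dotProduct_smul, hx]
  have := hker _ hHK
  rw [vsub_eq_sub, dotProduct_sub, (hou.mem_iff K).1 hK] at this
  exact (hou.mem_iff H).2 (by linarith)

/-- Every facet contains a full graph. -/
theorem IsFacetSet.exists_isFull (hN : 2 ≤ Fintype.card N) {S : Set (DAG N)}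
    (hS : IsFacetSet S) : ∃ G ∈ S, G.IsFull := by
  obtain ⟨o, u, hou⟩ := hS.1
  by_cases hmono : ∀ b B C, B ⊆ C → b ∉ C → localScore o b B ≤ localScore o b C
  · obtain ⟨G, hG⟩ := hS.nonempty hN
    obtain ⟨H, hH, hle⟩ := G.exists_isFull_ge
    refine ⟨H, (hou.mem_iff H).2 (le_antisymm (hou.1 _ (famVec_mem_familyVariablePolytope H)) ?_),
      hH⟩
    rw [← (hou.mem_iff G).1 hG, dotProduct_famVec, dotProduct_famVec]
    refine sum_le_sum fun a _ => hmono a _ _ (fun x hx => ?_) (H.self_notMem_parents a)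
    exact DAG.mem_parents.2 (hle _ _ (DAG.mem_parents.1 hx))
  · push Not at hmono
    obtain ⟨b, B, C, hBC, hb, hlt⟩ := hmono
    have hC : C.Nonempty := by
      rw [nonempty_iff_ne_empty]
      rintro rfl
      rw [subset_empty.1 hBC] at hlt
      exact lt_irrefl _ hlt
    -- Shrinking the parents of `b` from `C` to `B` would raise the score above `u`.
    have hSC : ∀ G ∈ S, G.parents b ≠ C := by
      intro G hG hGC
      let H : DAG N := G.ofLE (fun x y => G.Adj x y ∧ (y = b → x ∈ B)) fun _ _ h => h.1
      have hHadj : ∀ x y, x ∈ H.parents y ↔ G.Adj x y ∧ (y = b → x ∈ B) := fun x y =>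
        DAG.mem_parents
      have hHb : H.parents b = B := by
        ext x
        rw [hHadj]
        refine ⟨fun h => h.2 rfl, fun h => ⟨?_, fun _ => h⟩⟩
        rw [← DAG.mem_parents, hGC]
        exact hBC h
      have hHo : ∀ y, y ≠ b → H.parents y = G.parents y := by
        intro y hy
        ext x
        simp [hHadj, hy]
      have hval := hou.1 _ (famVec_mem_familyVariablePolytope H)
      rw [← (hou.mem_iff G).1 hG, dotProduct_famVec, dotProduct_famVec] at hval
      refine absurd hval (not_le.2 (sum_lt_sum (fun y _ => ?_) ⟨b, mem_univ b, ?_⟩))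
      · by_cases hy : y = b
        · rw [hy, hHb, hGC]
          exact hlt.le
        · rw [hHo y hy]
      · rw [hHb, hGC]
        exact hlt
    obtain ⟨c, hc⟩ := hC
    have hcb : b ≠ c := by
      rintro rfl
      exact hb hc
    -- With `b` ranked first its parent set is empty, hence not `C`.
    obtain ⟨r, hr, hrB, -⟩ := exists_rank (∅ : Finset N) hcb (by simp) (by simp)
    refine ⟨DAG.ofRank r, hS.mem_of_parents_ne hN ⟨c, hc⟩ hb hSC fun h => ?_, DAG.ofRank_isFull hr⟩
    rw [← h, DAG.mem_parents] at hc
    exact notMem_empty c ((hrB c).1 hc)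

end FamilyVariable

theorem theorem1 {N : Type*} [Fintype N] [DecidableEq N] (hN : 2 ≤ Fintype.card N)
    (S : Set (DAG N)) (hS : IsFacetSet S) :
    List.TFAE [
      ClosedUnderMarkovEquiv S,
      {G : DAG N | G.IsFull} ⊆ S,
      IsSEFace (codeHull S)] := by
  tfae_have 1 → 2 := by
    intro hcl H hH
    obtain ⟨G, hG, hfull⟩ := hS.exists_isFull hN
    exact hcl G H (hfull.markovEquiv hH) hG
  tfae_have 2 → 3 := by
    intro hfull
    obtain ⟨o, u, hou⟩ := hS.1
    exact ⟨o, u, isSEObjective_of_isFull o u fun G hG => (hou.mem_iff G).1 (hfull hG), hou⟩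
  tfae_have 3 → 1 := by
    rintro ⟨o, u, ho, hou⟩ G H hGH hG
    rw [hou.mem_iff] at hG ⊢
    rw [← ho G H hGH, hG]
  tfae_finish
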